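/- **Conventions.** Let $\Sigma$ be an alphabet with at least two characters and $\bot\notin\Sigma$ a wildcard character. For $1\le p\le n$, a string $T\in\Sigma^n$ has period $p$ if $T[1,n-p]=T[p+1,n]$ (so $p=n$ is always a period). A string $S\in(\Sigma\cup\{\bot\})^n$ has wildcard-period $p$ if each wildcard in $S$ can be assigned a character of $\Sigma$ so that the resulting string has period $p$. A (possibly randomized) one-pass streaming algorithm reads $S$ once, symbol by symbol, and updates a memory holding a bit string after each symbol, by an arbitrary function of the memory contents, the symbol, the number of symbols read and its random choices; at the end, its answer is a function of the final memory contents and its random choices. Access to the random bits is not charged. The algorithm may depend on $n$, $k$ and $\Sigma$. It computes the smallest wildcard-period with error probability at most $\delta$ if, on every $S\in(\Sigma\cup\{\bot\})^n$ with at most $k$ wildcards, its answer is the smallest wildcard-period of $S$ with probability at least $1-\delta$. Its space is the largest number of bits in memory, over all such $S$, all random choices and all times between arrivals of symbols (including the start and the end). **Theorem.** Any one-pass streaming algorithm that computes the smallest wildcard-period of a string of length $n$ with at most $k$ wildcard characters requires $\Omega(n)$ bits of space, even when randomization is allowed. That is, for every $\delta<\tfrac12$ there are a constant $c>0$ and an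 integer $N$, depending only on $\delta$, such that for all $n\ge N$, all $k\ge 0$ and all alphabets $\Sigma$ with at least two characters, every randomized one-pass streaming algorithm that computes the smallest wildcard-period of strings $S\in(\Sigma\cup\{\bot\})^n$ with at most $k$ wildcards with error probability at most $\delta$ uses at least $c\,n$ bits of space. (Deterministic algorithms are the special case without random choices.) -/

import Mathlib

open MeasureTheory

/-- A string of length `n` over the alphabet `α` that may contain wildcard characters.
The wildcard character is `none`. -/
abbrev WildcardString (α : Type*) (n : ℕ) : Type _ := Fin n → Option α

namespace WildcardString

/-- The number of wildcard characters in `S`. -/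
noncomputable def numWildcards {α : Type*} {n : ℕ} (S : WildcardString α n) : ℕ :=
  {i : Fin n | S i = none}.ncard

/-- `T` arises from `S` by assigning a character of `α` to each wildcard character. -/
def IsAssignment {α : Type*} {n : ℕ} (S : WildcardString α n) (T : Fin n → α) : Prop :=
  ∀ (i : Fin n) (a : α), S i = some a → T i = a

end WildcardString

/-- The (wildcard-free) string `T` of length `n` has period `p`, where `1 ≤ p ≤ n`: its prefix of
length `n - p` equals its suffix of length `n - p`. -/
def HasPeriod {α : Type*} {n : ℕ} (T : Fin n → α) (p : ℕ) : Prop :=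
  1 ≤ p ∧ p ≤ n ∧ ∀ (i : ℕ) (h : i + p < n), T ⟨i, by omega⟩ = T ⟨i + p, h⟩

namespace WildcardString

/-- `S` has wildcard-period `p`: some assignment to the wildcards yields a string of period `p`. -/
def HasWildcardPeriod {α : Type*} {n : ℕ} (S : WildcardString α n) (p : ℕ) : Prop :=
  ∃ T : Fin n → α, S.IsAssignment T ∧ HasPeriod T p

/-- `p` is the smallest wildcard-period of `S`. -/
def IsSmallestWildcardPeriod {α : Type*} {n : ℕ} (S : WildcardString α n) (p : ℕ) : Prop :=
  IsLeast {q : ℕ | S.HasWildcardPeriod q} p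

end WildcardString

/-- A deterministic one-pass streaming algorithm reading symbols from `β`. Its memory contents are
finite bit strings. The memory is updated by an arbitrary function each time a symbol arrives; the
number of symbols read so far is available to the update for free. When the stream ends, the answer
is a function of the memory contents. -/
structure StreamAlgorithm (β : Type*) where
  init : List Bool
  step : ℕ → List Bool → β → List Bool
  output : List Bool → ℕ

namespace StreamAlgorithm

/-- The memory contents after the first `t` symbols of the stream `S` have been read. -/
def memory {β : Type*} (A : StreamAlgorithm β) {n : ℕ} (S : Fin n → β) : ℕ → List Bool
  | 0 => A.init
  | t + 1 => if h : t < n then A.step t (A.memory S t) (S ⟨t, h⟩) else A.memory S t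

/-- The answer of the algorithm on the stream `S`. -/
def answer {β : Type*} (A : StreamAlgorithm β) {n : ℕ} (S : Fin n → β) : ℕ :=
  A.output (A.memory S n)

end StreamAlgorithm

/-- A randomized one-pass streaming algorithm for streams of length `n`: the outcome `ω` of all
random choices determines a deterministic algorithm, and the answer on each input is a random
variable. Access to the random bits is not charged as space. A deterministic algorithm is the case
of a one-point `Ω`. -/
structure RandomizedStreamAlgorithm (Ω : Type*) [MeasurableSpace Ω] (β : Type*) (n : ℕ) where
  alg : Ω → StreamAlgorithm β
  measurable_answer : ∀ S : Fin n → β, Measurable fun ω => (alg ω).answer S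

namespace RandomizedStreamAlgorithm

/-- On every string of length `n` with at most `k` wildcards, the algorithm outputs the smallest
wildcard-period with probability at least `1 - δ`. -/
def ComputesSmallestWildcardPeriod {Ω : Type*} [MeasurableSpace Ω] {α : Type*} {n : ℕ}
    (A : RandomizedStreamAlgorithm Ω (Option α) n) (μ : Measure Ω) (k : ℕ) (δ : ℝ) : Prop :=
  ∀ S : WildcardString α n, S.numWildcards ≤ k →
    1 - δ ≤ μ.real {ω | S.IsSmallestWildcardPeriod ((A.alg ω).answer S)}

/-- On every string of length `n` with at most `k` wildcards, and for all random choices, the memory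
never holds more than `s` bits at the start, after a symbol has been read, or at the end. -/
def UsesSpaceAtMost {Ω : Type*} [MeasurableSpace Ω] {α : Type*} {n : ℕ}
    (A : RandomizedStreamAlgorithm Ω (Option α) n) (k s : ℕ) : Prop :=
  ∀ S : WildcardString α n, S.numWildcards ≤ k →
    ∀ (ω : Ω) (t : ℕ), t ≤ n → ((A.alg ω).memory S t).length ≤ s

end RandomizedStreamAlgorithm

/-! The proof reduces from augmented indexing and needs no wildcards. Alice's bits `x` are written
as a prefix `0 0 1 x₀ 1 x₁ …`; the memory after that prefix is her message. Bob, who knows `i` and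
the bits before `i`, pads with ones and ends the stream with a copy of the prefix through `xᵢ`, with
`xᵢ` replaced by `1`. A period `p ≤ n - 2` must carry the initial `0 0` to another `0 0`, and the
only other one starts Bob's copy; that shift is a period exactly when `xᵢ = 1`
(`smallestPeriod_indexString`). Averaging over all `(x, i)` fixes the random choices with at most a
`δ`-fraction of wrong predictions. For a fixed message, the map from `x` to the error pattern is a
bijection, so few `x` have few errors; covering all `x` forces many messages
(`augmented_index_bound`). -/

/-! ### Augmented indexing -/

open Finset in
/-- The number of bits of `x` that the predictor `g` gets wrong, weighted exponentially and summed
over all `x`. If the prediction of each bit depends on the earlier bits only, then the map from `x`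
to its error pattern is a bijection. -/
theorem sum_prod_error_weight {m : ℕ} (g : Fin m → (Fin m → Bool) → Bool)
    (hg : ∀ i x y, (∀ r < i, x r = y r) → g i x = g i y) (w : ℝ) :
    ∑ x : Fin m → Bool, ∏ i, (if g i x = x i then 1 else w) = (1 + w) ^ m := by
  classical
  have hinj : Function.Injective fun (x : Fin m → Bool) i => xor (g i x) (x i) := by
    intro x y hxy
    funext i
    induction i using WellFoundedLT.induction with
    | ind i ih =>
      have h1 := congrFun hxy i
      simp only [hg i x y ih] at h1
      simpa using h1
  have hbij := hinj.bijective_of_finite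
  have h1 : ∀ x : Fin m → Bool, ∏ i, (if g i x = x i then 1 else w) =
      ∏ i, (fun b : Bool => if b then w else 1) (xor (g i x) (x i)) := by
    intro x
    refine prod_congr rfl fun i _ => ?_
    cases g i x <;> cases x i <;> simp
  simp_rw [h1]
  rw [hbij.sum_comp (fun e : Fin m → Bool => ∏ i, (fun b : Bool => if b then w else 1) (e i)),
    ← Fintype.piFinset_univ, sum_prod_piFinset univ fun _ (b : Bool) => if b then w else 1]
  simp [add_comm]

/-- There are fewer than `2 ^ (s + 1)` bit strings of length at most `s`. -/
theorem card_le_of_length_le {Y : Finset (List Bool)} {s : ℕ} (h : ∀ y ∈ Y, y.length ≤ s) :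
    Y.card ≤ 2 ^ (s + 1) := by
  classical
  have hsub : Y ⊆ (Finset.range (s + 1)).biUnion fun l =>
      (Finset.univ : Finset (Fin l → Bool)).image List.ofFn := by
    intro y hy
    exact Finset.mem_biUnion.2 ⟨y.length, Finset.mem_range.2 (Nat.lt_succ_of_le (h y hy)),
      Finset.mem_image.2 ⟨y.get, Finset.mem_univ _, List.ofFn_get y⟩⟩
  calc Y.card ≤ _ := Finset.card_le_card hsub
    _ ≤ ∑ l ∈ Finset.range (s + 1), 2 ^ l := by
      refine Finset.card_biUnion_le.trans (Finset.sum_le_sum fun l _ => ?_)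
      refine Finset.card_image_le.trans ?_
      simp
    _ ≤ 2 ^ (s + 1) := (Nat.geomSum_lt le_rfl (by simp)).le

/-- One-way communication bound for augmented indexing, for a deterministic protocol: the message
`M x` and the earlier bits of `x` allow a prediction of each bit of `x`. -/
theorem augmented_index_bound {m s : ℕ} (M : (Fin m → Bool) → List Bool)
    (hM : ∀ x, (M x).length ≤ s) (g : List Bool → Fin m → (Fin m → Bool) → Bool)
    (hg : ∀ l i x y, (∀ r < i, x r = y r) → g l i x = g l i y) {δ : ℝ} (hδ : δ < 1 / 2)
    (herr : ∑ x : Fin m → Bool, ∑ i, (if g (M x) i x = x i then (0 : ℝ) else 1)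
      ≤ δ * m * 2 ^ m) :
    3 * (1 - 2 * δ) ^ 2 * m / 8 ≤ s + 1 := by
  classical
  -- The estimates below give `m * (t * (1 - 2 * δ) / 2 - t ^ 2 / 8) ≤ s + 1`, which is positive on
  -- the left for this `t`.
  obtain ⟨t, ht⟩ : ∃ t, t = 1 - 2 * δ := ⟨_, rfl⟩
  have ht0 : 0 < t := by linarith
  set E : (Fin m → Bool) → ℝ := fun x => ∑ i, (if g (M x) i x = x i then (0 : ℝ) else 1)
  have hexp : ∀ l x, ∏ i, (if g l i x = x i then 1 else Real.exp (-t)) =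
      Real.exp (-t * ∑ i, (if g l i x = x i then (0 : ℝ) else 1)) := by
    intro l x
    rw [Finset.mul_sum, Real.exp_sum]
    refine Finset.prod_congr rfl fun i _ => ?_
    split_ifs <;> simp
  -- Jensen's inequality, via the tangent line of the exponential at `δ * m` errors.
  have lower : Real.exp (-t * (δ * m)) * 2 ^ m ≤ ∑ x, Real.exp (-t * E x) := by
    have h1 : ∀ x, Real.exp (-t * (δ * m)) * (1 + t * (δ * m) - t * E x) ≤
        Real.exp (-t * E x) := by
      intro x
      have h2 := Real.add_one_le_exp (-t * E x - -t * (δ * m))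
      calc _ ≤ Real.exp (-t * (δ * m)) * Real.exp (-t * E x - -t * (δ * m)) := by
            gcongr; linarith
        _ = _ := by rw [← Real.exp_add]; congr 1; ring
    refine le_trans ?_ (Finset.sum_le_sum fun x _ => h1 x)
    rw [← Finset.mul_sum, Finset.sum_sub_distrib, ← Finset.mul_sum]
    have h3 : t * ∑ x, E x ≤ t * (δ * m * 2 ^ m) := by gcongr
    gcongr
    simp only [Finset.sum_const, Finset.card_univ, Fintype.card_pi, Fintype.card_bool,
      Finset.prod_const, Fintype.card_fin, nsmul_eq_mul]
    push_cast
    linarith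
  -- Summing over all messages, not just the one sent, decouples `l` from `x`.
  have upper : ∑ x, Real.exp (-t * E x) ≤ 2 ^ (s + 1) * (1 + Real.exp (-t)) ^ m := by
    calc ∑ x, Real.exp (-t * E x)
        ≤ ∑ x, ∑ l ∈ Finset.univ.image M,
            ∏ i, (if g l i x = x i then 1 else Real.exp (-t)) := by
          refine Finset.sum_le_sum fun x _ => ?_
          rw [← hexp]
          exact Finset.single_le_sum
            (f := fun l => ∏ i, (if g l i x = x i then 1 else Real.exp (-t)))
            (fun l _ => by rw [hexp]; positivity) (Finset.mem_image_of_mem M (Finset.mem_univ x))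
      _ = (Finset.univ.image M).card * (1 + Real.exp (-t)) ^ m := by
          rw [Finset.sum_comm]
          simp_rw [sum_prod_error_weight (g _) (hg _)]
          simp
      _ ≤ _ := by
          gcongr
          exact_mod_cast card_le_of_length_le (by simpa using hM)
  have hcosh : 1 + Real.exp (-t) ≤ 2 * Real.exp (-t / 2 + t ^ 2 / 8) := by
    have h1 := Real.cosh_le_exp_half_sq (t / 2)
    have h2 : 1 + Real.exp (-t) = 2 * (Real.exp (-t / 2) * Real.cosh (t / 2)) := by
      rw [Real.cosh_eq, mul_div_assoc', mul_div_cancel₀ _ two_ne_zero, mul_add, ← Real.exp_add,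
        ← Real.exp_add]
      ring_nf
      rw [Real.exp_zero, add_comm]
    rw [h2, Real.exp_add]
    gcongr
    exact h1.trans_eq (by ring_nf)
  have hs : (2 : ℝ) ^ (s + 1) ≤ Real.exp (s + 1) := by
    have := Real.add_one_le_exp 1
    calc (2 : ℝ) ^ (s + 1) ≤ Real.exp 1 ^ (s + 1) := by gcongr; linarith
      _ = _ := by rw [← Real.exp_nat_mul]; simp
  have key : Real.exp (-t * (δ * m)) * 2 ^ m ≤
      Real.exp (s + 1 + m * (-t / 2 + t ^ 2 / 8)) * 2 ^ m := by
    calc _ ≤ _ := lower.trans upper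
      _ ≤ Real.exp (s + 1) * (2 * Real.exp (-t / 2 + t ^ 2 / 8)) ^ m := by gcongr
      _ = _ := by rw [mul_pow, Real.exp_add (s + 1 : ℝ), Real.exp_nat_mul]; ring
  have key' := Real.exp_le_exp.1 (le_of_mul_le_mul_right key (by positivity))
  have h4 : δ = (1 - t) / 2 := by linarith
  rw [← ht]
  rw [h4] at key'
  linarith

/-! ### Splitting a run at an intermediate time -/

namespace StreamAlgorithm

/-- The memory contents after the symbols of `S` at positions `t₀, …, t₀ + t - 1` have been read,
starting from memory contents `l` at time `t₀`. -/
def resume {β : Type*} (A : StreamAlgorithm β) {n : ℕ} (S : Fin n → β) (t₀ : ℕ) (l : List Bool) :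
    ℕ → List Bool
  | 0 => l
  | t + 1 =>
    if h : t₀ + t < n then A.step (t₀ + t) (A.resume S t₀ l t) (S ⟨t₀ + t, h⟩)
    else A.resume S t₀ l t

theorem resume_memory {β : Type*} (A : StreamAlgorithm β) {n : ℕ} (S : Fin n → β) (t₀ t : ℕ) :
    A.resume S t₀ (A.memory S t₀) t = A.memory S (t₀ + t) := by
  induction t with
  | zero => rfl
  | succ t ih => rw [resume, ih, ← add_assoc, memory]

/-- Bob can finish the run from the message knowing only the later symbols. -/
theorem resume_congr {β : Type*} (A : StreamAlgorithm β) {n : ℕ} {S S' : Fin n → β} {t₀ : ℕ}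
    (h : ∀ j : Fin n, t₀ ≤ j → S j = S' j) (l : List Bool) (t : ℕ) :
    A.resume S t₀ l t = A.resume S' t₀ l t := by
  induction t with
  | zero => rfl
  | succ t ih =>
    simp only [resume, ih]
    split_ifs with ht
    · rw [h _ (Nat.le_add_right _ _)]
    · rfl

theorem memory_congr {β : Type*} (A : StreamAlgorithm β) {n : ℕ} {S S' : Fin n → β} {t : ℕ}
    (h : ∀ j : Fin n, (j : ℕ) < t → S j = S' j) : A.memory S t = A.memory S' t := by
  induction t with
  | zero => rfl
  | succ t ih =>
    simp only [memory, ih fun j hj => h j (hj.trans (Nat.lt_succ_self t))]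
    split_ifs with ht
    · rw [h _ (Nat.lt_succ_self t)]
    · rfl

end StreamAlgorithm

/-! ### The hard strings and their periods -/

/-- The infinite bit sequence `0 0 1 x₀ 1 x₁ … 1 xₘ₋₁ 1 1 1 …`. -/
def spreadBits {m : ℕ} (x : Fin m → Bool) (j : ℕ) : Bool :=
  if j < 2 then false
  else if h : j % 2 = 1 ∧ (j - 3) / 2 < m then x ⟨(j - 3) / 2, h.2⟩ else true

/-- The bit string of length `n` that starts with the bits of `spreadBits x` and ends with
`0 0 1 x₀ 1 x₁ … 1 xᵢ₋₁ 1 1`. -/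
def indexBits {m : ℕ} (n : ℕ) (x : Fin m → Bool) (i : Fin m) (j : ℕ) : Bool :=
  if j + (2 * i + 4) < n then spreadBits x j
  else if j + 1 = n then true else spreadBits x (j + (2 * i + 4) - n)

/-- Data bits sit at odd positions, so every even position from `2` on holds a one. -/
theorem spreadBits_pair {m : ℕ} (x : Fin m → Bool) {j : ℕ} (hj : 0 < j) :
    spreadBits x j = true ∨ spreadBits x (j + 1) = true := by
  unfold spreadBits
  by_cases h : j % 2 = 1
  · right
    rw [if_neg (by omega), dif_neg (by omega)]
  · left
    rw [if_neg (by omega), dif_neg (by omega)]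

theorem spreadBits_of_le {m : ℕ} (x : Fin m → Bool) {j : ℕ} (hj : 2 * m + 2 ≤ j) :
    spreadBits x j = true := by
  unfold spreadBits
  rw [if_neg (by omega), dif_neg (by omega)]

theorem spreadBits_bit {m : ℕ} (x : Fin m → Bool) (i : Fin m) :
    spreadBits x (2 * i + 3) = x i := by
  unfold spreadBits
  rw [if_neg (by omega), dif_pos ⟨by omega, by omega⟩]
  congr 1
  ext
  simp

theorem spreadBits_congr {m : ℕ} {x y : Fin m → Bool} {i : Fin m} (h : ∀ r < i, x r = y r) {j : ℕ}
    (hj : j < 2 * i + 3) : spreadBits x j = spreadBits y j := by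
  unfold spreadBits
  split_ifs with h1 h2
  · rfl
  · exact h _ (by rw [Fin.lt_def]; simp only; omega)
  · rfl

/-- Two consecutive zeros occur in the string at positions `0` and `n - (2 * i + 4)` only. -/
theorem indexBits_eq_of_pair {m n : ℕ} (hn : 4 * m + 5 ≤ n) (x : Fin m → Bool) (i : Fin m) {p : ℕ}
    (hp : 0 < p) (hpn : p + 1 < n) (h0 : indexBits n x i p = false)
    (h1 : indexBits n x i (p + 1) = false) : p + (2 * i + 4) = n := by
  have hi := i.2
  by_contra hne
  unfold indexBits at h0 h1
  rcases lt_or_gt_of_ne hne with hlt | hgt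
  · rw [if_pos hlt] at h0
    by_cases h2 : p + 1 + (2 * i + 4) < n
    · rw [if_pos h2] at h1
      rcases spreadBits_pair x hp with h | h <;> simp_all
    -- Here `p` is just before the suffix; `4 * m + 5 ≤ n` leaves room for a separating one there.
    · rw [spreadBits_of_le x (by omega)] at h0
      simp at h0
  · rw [if_neg (by omega), if_neg (by omega)] at h0
    rw [if_neg (by omega)] at h1
    split_ifs at h1
    rw [show p + 1 + (2 * (i : ℕ) + 4) - n = p + (2 * i + 4) - n + 1 by omega] at h1
    rcases spreadBits_pair x (j := p + (2 * i + 4) - n) (by omega) with h | h <;> simp_all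

/-- The bit string `indexBits` as a wildcard-free string over `α`. -/
def indexString {α : Type*} (a b : α) {m : ℕ} (n : ℕ) (x : Fin m → Bool) (i : Fin m) :
    WildcardString α n :=
  fun j => some (if indexBits n x i j then b else a)

theorem numWildcards_indexString {α : Type*} (a b : α) {m : ℕ} (n : ℕ) (x : Fin m → Bool)
    (i : Fin m) : (indexString a b n x i).numWildcards = 0 := by
  simp [WildcardString.numWildcards, indexString]

theorem hasWildcardPeriod_indexString_iff {α : Type*} {a b : α} (hab : a ≠ b) {m n : ℕ}
    (x : Fin m → Bool) (i : Fin m) (p : ℕ) :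
    (indexString a b n x i).HasWildcardPeriod p ↔
      1 ≤ p ∧ p ≤ n ∧ ∀ j, j + p < n → indexBits n x i j = indexBits n x i (j + p) := by
  constructor
  · rintro ⟨T, hT, h1, h2, h3⟩
    refine ⟨h1, h2, fun j hj => ?_⟩
    have h4 := h3 j hj
    rw [hT _ _ rfl, hT _ _ rfl] at h4
    revert h4
    simp only
    cases indexBits n x i j <;> cases indexBits n x i (j + p) <;> simp [hab, hab.symm]
  · rintro ⟨h1, h2, h3⟩
    refine ⟨fun j => if indexBits n x i j then b else a, fun j c hc => ?_, h1, h2, fun j hj => ?_⟩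
    · simpa [indexString] using hc
    · simp only [h3 j hj]

/-- The smallest period of the string reveals the bit `x i`. -/
theorem smallestPeriod_indexString {α : Type*} {a b : α} (hab : a ≠ b) {m n : ℕ}
    (hn : 4 * m + 5 ≤ n) (x : Fin m → Bool) (i : Fin m) {p : ℕ}
    (hp : (indexString a b n x i).IsSmallestWildcardPeriod p) :
    decide (p + (2 * i + 4) = n) = x i := by
  have hi := i.2
  obtain ⟨hmem, hleast⟩ := hp
  rw [Set.mem_ofPred_eq, hasWildcardPeriod_indexString_iff hab] at hmem
  obtain ⟨h1, h2, h3⟩ := hmem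
  have zero_of_lt : ∀ j < 2, indexBits n x i j = false := by
    intro j hj
    rw [indexBits, if_pos (by omega), spreadBits, if_pos hj]
  by_cases hx : x i = true
  · rw [hx, decide_eq_true_iff]
    have hq : (indexString a b n x i).HasWildcardPeriod (n - (2 * i + 4)) := by
      rw [hasWildcardPeriod_indexString_iff hab]
      refine ⟨by omega, by omega, fun j hj => ?_⟩
      rw [indexBits, if_pos (by omega), indexBits, if_neg (by omega)]
      split_ifs with h
      · rw [← hx, ← spreadBits_bit x i]
        congr 1
        omega
      · congr 1
        omega
    have hle := hleast hq
    refine indexBits_eq_of_pair hn x i h1 (by omega) ?_ ?_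
    · rw [← zero_of_lt 0 (by omega), h3 0 (by omega), zero_add]
    · rw [← zero_of_lt 1 (by omega), h3 1 (by omega), add_comm]
  · rw [Bool.not_eq_true] at hx
    rw [hx, decide_eq_false_iff_not]
    intro hpn
    have h4 := h3 (2 * i + 3) (by omega)
    rw [indexBits, if_pos (by omega), spreadBits_bit, hx, indexBits, if_neg (by omega),
      if_pos (by omega)] at h4
    simp at h4

/-! ### Averaging and the reduction -/

/-- A random experiment in which each of finitely many events has probability at least `1 - δ` has
an outcome at which at most a `δ`-fraction of the events fails. -/
theorem exists_sum_failures_le {Ω : Type*} [MeasurableSpace Ω] (μ : Measure Ω)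
    [IsProbabilityMeasure μ] {ι : Type*} [Fintype ι] (C : ι → Set Ω)
    (hC : ∀ i, MeasurableSet (C i)) {δ : ℝ} (h : ∀ i, 1 - δ ≤ μ.real (C i)) :
    ∃ ω, ∑ i, (C i)ᶜ.indicator (fun _ => (1 : ℝ)) ω ≤ δ * Fintype.card ι := by
  have hint : ∀ i, Integrable ((C i)ᶜ.indicator fun _ => (1 : ℝ)) μ := fun i =>
    (integrable_const 1).indicator (hC i).compl
  obtain ⟨ω, hω⟩ := exists_le_integral (μ := μ)
    (integrable_finsetSum Finset.univ fun i _ => hint i)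
  refine ⟨ω, hω.trans ?_⟩
  rw [integral_finsetSum _ fun i _ => hint i]
  calc ∑ i, ∫ a, (C i)ᶜ.indicator (fun _ => (1 : ℝ)) a ∂μ ≤ ∑ _i : ι, δ := by
        refine Finset.sum_le_sum fun i _ => ?_
        rw [integral_indicator_const _ (hC i).compl, probReal_compl_eq_one_sub (hC i)]
        simpa using by linarith [h i]
    _ = _ := by simp [mul_comm]

theorem space_lower_bound {α Ω : Type*} [Nontrivial α] [MeasurableSpace Ω] (μ : Measure Ω)
    [IsProbabilityMeasure μ] {n m k s : ℕ} (hn : 4 * m + 5 ≤ n)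
    (A : RandomizedStreamAlgorithm Ω (Option α) n) {δ : ℝ} (hδ : δ < 1 / 2)
    (hA : A.ComputesSmallestWildcardPeriod μ k δ) (hs : A.UsesSpaceAtMost k s) :
    3 * (1 - 2 * δ) ^ 2 * m / 8 ≤ s + 1 := by
  classical
  rcases Nat.eq_zero_or_pos m with rfl | hm
  · simp only [Nat.cast_zero, mul_zero, zero_div]
    positivity
  obtain ⟨a, b, hab⟩ := exists_pair_ne α
  have hwild : ∀ (x : Fin m → Bool) i, (indexString a b n x i).numWildcards ≤ k := fun x i =>
    (numWildcards_indexString a b n x i).trans_le (Nat.zero_le k)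
  obtain ⟨ω, hω⟩ := exists_sum_failures_le μ
    (fun xi : (Fin m → Bool) × Fin m =>
      {ω | (indexString a b n xi.1 xi.2).IsSmallestWildcardPeriod
        ((A.alg ω).answer (indexString a b n xi.1 xi.2))})
    (fun xi => A.measurable_answer (indexString a b n xi.1 xi.2)
      (MeasurableSet.of_discrete
        (s := {p | (indexString a b n xi.1 xi.2).IsSmallestWildcardPeriod p})))
    (fun xi => hA _ (hwild xi.1 xi.2))
  set B := A.alg ω
  -- The prefix does not depend on `i`, so index `0` serves to define the message from `x` alone.
  have hmem : ∀ (x : Fin m → Bool) i,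
      B.memory (indexString a b n x i) (2 * m + 2) =
        B.memory (indexString a b n x ⟨0, hm⟩) (2 * m + 2) := by
    intro x i
    have hi := i.2
    refine B.memory_congr fun j hj => ?_
    have hbits : ∀ i' : Fin m, indexBits n x i' j = spreadBits x j := fun i' =>
      if_pos (by have := i'.2; omega)
    rw [indexString, indexString, hbits, hbits]
  refine augmented_index_bound
    (fun x => B.memory (indexString a b n x ⟨0, hm⟩) (2 * m + 2))
    (fun x => hs _ (hwild _ _) ω _ (by omega))
    (fun l i x => decide (B.output (B.resume (indexString a b n x i) (2 * m + 2) l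
      (n - (2 * m + 2))) + (2 * i + 4) = n)) ?_ hδ ?_
  · intro l i x y hxy
    have hi := i.2
    rw [B.resume_congr (S' := indexString a b n y i)]
    intro j hj
    have hj2 := j.2
    have hbits : indexBits n x i j = indexBits n y i j := by
      unfold indexBits
      split_ifs with h1 h2
      · rw [spreadBits_of_le x hj, spreadBits_of_le y hj]
      · rfl
      -- The fixed final one keeps `x i` itself out of the suffix.
      · exact spreadBits_congr hxy (by omega)
    rw [indexString, indexString, hbits]
  · rw [← Fintype.sum_prod_type']
    refine le_trans (Finset.sum_le_sum fun xi _ => ?_) (hω.trans_eq ?_)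
    · rw [← hmem xi.1 xi.2, B.resume_memory, show 2 * m + 2 + (n - (2 * m + 2)) = n by omega]
      by_cases hc : (indexString a b n xi.1 xi.2).IsSmallestWildcardPeriod
          (B.answer (indexString a b n xi.1 xi.2))
      · rw [if_pos]
        · exact Set.indicator_nonneg (fun _ _ => zero_le_one) _
        · exact smallestPeriod_indexString hab hn xi.1 xi.2 hc
      · rw [Set.indicator_of_mem (by exact hc)]
        split_ifs <;> norm_num
    · simp only [Fintype.card_prod, Fintype.card_pi, Fintype.card_bool, Finset.prod_const,
        Finset.card_univ, Fintype.card_fin]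
      push_cast
      ring

theorem mainTheorem4 (δ : ℝ) (hδ : δ < 1 / 2) :
    ∃ c : ℝ, 0 < c ∧ ∃ N : ℕ,
      ∀ (α : Type*) [Nontrivial α]
        (Ω : Type*) [MeasurableSpace Ω] (μ : Measure Ω) [IsProbabilityMeasure μ]
        (n k s : ℕ) (A : RandomizedStreamAlgorithm Ω (Option α) n),
        N ≤ n →
        A.ComputesSmallestWildcardPeriod μ k δ →
        A.UsesSpaceAtMost k s →
        c * (n : ℝ) ≤ (s : ℝ) := by
  have ht : 0 < (1 - 2 * δ) ^ 2 := by
    have : 0 < 1 - 2 * δ := by linarith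
    positivity
  -- With `u = (1 - 2 * δ) ^ 2` and `m ≥ (n - 8) / 4`, the bound `3 * u * (n - 8) / 32 - 1 ≥ u * n /
  -- 32` amounts to `u * n ≥ 12 * u + 16`.
  refine ⟨(1 - 2 * δ) ^ 2 / 32, by positivity, ⌈12 + 16 / (1 - 2 * δ) ^ 2⌉₊, ?_⟩
  intro α _ Ω _ μ _ n k s A hN hA hs
  have hN' : 12 + 16 / (1 - 2 * δ) ^ 2 ≤ n := Nat.ceil_le.1 hN
  have hn : (12 : ℝ) ≤ n := by
    have : 0 < 16 / (1 - 2 * δ) ^ 2 := by positivity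
    linarith
  have hn' : 12 ≤ n := by exact_mod_cast hn
  have key := space_lower_bound μ (m := (n - 5) / 4) (by omega) A hδ hA hs
  have hm : (n : ℝ) ≤ 4 * ((n - 5) / 4 : ℕ) + 8 := by
    exact_mod_cast (by omega : n ≤ 4 * ((n - 5) / 4) + 8)
  generalize (1 - 2 * δ) ^ 2 = u at *
  have h1 : 12 * u + 16 ≤ n * u := by
    have := mul_le_mul_of_nonneg_right hN' ht.le
    rwa [add_mul, div_mul_cancel₀ _ ht.ne'] at this
  have h2 := mul_le_mul_of_nonneg_left hm ht.le
  linarith
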